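/- **Proposition 2.4.** Let $M$ be a $C^\infty$ smooth paracompact Hausdorff manifold without boundary, of dimension $n$, and let $1\le r\le\infty$. *Groups.* Let $\mathrm{Diff}^r(M)$ be the group of $C^r$ diffeomorphisms of $M$. A $C^r$ isotopy in a subgroup $G\le \mathrm{Diff}^r(M)$ is a family $(f_t)_{t\in\mathbb R}$ in $G$ with $f_0=\mathrm{id}$ such that $(t,x)\mapsto f_t(x)$ is of class $C^r$ on $\mathbb R\times M$; it is compactly supported if there is a compact set $K\subset M$ such that every $f_t$ is the identity outside $K$. Let $\mathfrak G^r(M)$ (resp. $\mathfrak G^r_c(M)$) be the class of subgroups $G\le\mathrm{Diff}^r(M)$ that are isotopically connected (resp. isotopically connected through compactly supported isotopies), i.e. such that every $g\in G$ equals $f_1$ for some isotopy (resp. some compactly supported isotopy) $(f_t)$ in $G$. Then $\mathfrak G^r_c(M)\subset\mathfrak G^r(M)$. *Foliations.* A subset $L\subset M$ with a $C^r$ manifold structure for which the inclusion $L\to M$ is an immersion is weakly imbedded if, for every locally connected space $N$, every continuous map $f:N\to M$ with $f(N)\subset L$ is continuous as a map to $L$; such a structure on $L$ is unique. A (singular)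 foliation of class $C^r$ of $M$ is a partition $\mathcal F$ of $M$ into connected weakly imbedded submanifolds of class $C^r$, called leaves, such that for every $x\in M$, if $k$ is the dimension of the leaf through $x$, there is a $C^r$ chart $(U,\phi)$ of $M$ at $x$ with $\phi(x)=0$ and $\phi(U)=V\times W$, where $V\subset\mathbb R^k$ and $W\subset\mathbb R^{n-k}$ are open, such that $\phi(L\cap U)=V\times\{w\in W:\phi^{-1}(0,w)\in L\}$ for every $L\in\mathcal F$. Let $\mathfrak F^r(M)$ be the class of these foliations. *The maps.* For $\mathcal F\in\mathfrak F^r(M)$ let $\mathrm{Diff}^r(M,\mathcal F)$ be the group of those $f\in\mathrm{Diff}^r(M)$ with $f(L)=L$ for every leaf $L\in\mathcal F$, and let $\alpha_M(\mathcal F)=G_{\mathcal F}:=\mathrm{Diff}^r_c(M,\mathcal F)_0\in\mathfrak G^r_c(M)$ be its subgroup of the elements that can be joined to the identity through a compactly supported $C^r$ isotopy in $\mathrm{Diff}^r(M,\mathcal F)$. A $C^r$-arrow is a $C^r$ map $\phi$ of an open subset of $\mathbb R\times M$ into $M$ such that each $\phi_t=\phi(t,\cdot)$ is a $C^r$ diffeomorphism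 of an open (possibly empty) subset of $M$ onto an open subset of $M$, $\phi_0=\mathrm{id}$ on its domain, and $\mathrm{dom}(\phi_t)\subset\mathrm{dom}(\phi_s)$ whenever $0\le s<t$. For a set $\mathcal A$ of arrows, the accessible sets of $\mathcal A$ are the orbits of the finite compositions of the local diffeomorphisms $\phi_t$ and $\phi_t^{-1}$ ($\phi\in\mathcal A$, $t\in\mathbb R$) and of the identity. For $G\in\mathfrak G^r(M)$ let $\beta_M(G)=\mathcal F_G$ be the partition of $M$ into the accessible sets of the set $\mathcal A_G$ of all arrows that are restrictions of isotopies in $G$ to open subsets of $\mathbb R\times M$. Then $\beta_M(\alpha_M(\mathcal F))=\mathcal F$ for every $\mathcal F\in\mathfrak F^r(M)$, that is, $\beta_M\circ\alpha_M=\mathrm{id}_{\mathfrak F^r(M)}$. In particular, $\alpha_M:\mathfrak F^r(M)\to\mathfrak G^r_c(M)$, $\mathcal F\mapsto G_{\mathcal F}$, is an injection, which identifies the $C^r$ foliations of $M$ with a subclass of the isotopically connected groups of $C^r$ diffeomorphisms of $M$. -/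

import Mathlib

open Set Function
open scoped Manifold ContDiff

namespace StefanFoliation

universe u

/-! ### The group of diffeomorphisms of class `C^r` -/

/-- `Diff^r(M)` for a manifold `M` of dimension `n`. -/
abbrev CrDiffeo (n : ℕ) (r : ℕ∞ω) (M : Type u) [TopologicalSpace M]
    [ChartedSpace (EuclideanSpace ℝ (Fin n)) M] : Type u :=
  M ≃ₘ^r⟮𝓡 n, 𝓡 n⟯ M

section Manifold

variable {n : ℕ} {r : ℕ∞ω} {M : Type u} [TopologicalSpace M]
  [ChartedSpace (EuclideanSpace ℝ (Fin n)) M]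

/-- The group structure on `Diff^r(M)`; the product is composition, `(f * g) x = f (g x)`. -/
noncomputable instance instGroupCrDiffeo : Group (CrDiffeo n r M) where
  mul f g := g.trans f
  one := Diffeomorph.refl (𝓡 n) M r
  inv f := f.symm
  mul_assoc _ _ _ := rfl
  one_mul _ := rfl
  mul_one _ := rfl
  inv_mul_cancel f := Diffeomorph.ext fun x => f.symm_apply_apply x

@[simp] theorem mul_apply (f g : CrDiffeo n r M) (x : M) : (f * g) x = f (g x) := rfl

@[simp] theorem one_apply (x : M) : (1 : CrDiffeo n r M) x = x := rfl

@[simp] theorem inv_apply_self (f : CrDiffeo n r M) (x : M) : f⁻¹ (f x) = x :=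
  f.symm_apply_apply x

@[simp] theorem apply_inv_self (f : CrDiffeo n r M) (x : M) : f (f⁻¹ x) = x :=
  f.apply_symm_apply x

/-! ### Isotopies and isotopically connected groups -/

/-- `(f_t)_{t ∈ ℝ}` is a `C^r` isotopy in the group `G`: the map `(t, x) ↦ f_t x` is of class `C^r`
on `ℝ × M`, `f_0 = id`, and `f_t ∈ G` for all `t`. -/
structure IsIsotopyIn (G : Subgroup (CrDiffeo n r M)) (f : ℝ → CrDiffeo n r M) : Prop where
  contMDiff : ContMDiff (𝓘(ℝ, ℝ).prod (𝓡 n)) (𝓡 n) r (fun p : ℝ × M => f p.1 p.2)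
  zero : f 0 = 1
  mem : ∀ t, f t ∈ G

/-- The isotopy is the identity outside one compact set. -/
def IsCompactlySupported (f : ℝ → CrDiffeo n r M) : Prop :=
  ∃ K : Set M, IsCompact K ∧ ∀ t, ∀ x ∉ K, f t x = x

/-- `G` is isotopically connected. -/
def IsotopicallyConnected (G : Subgroup (CrDiffeo n r M)) : Prop :=
  ∀ g ∈ G, ∃ f : ℝ → CrDiffeo n r M, IsIsotopyIn G f ∧ f 1 = g

/-- `G` is isotopically connected through compactly supported isotopies. -/
def CompactlyIsotopicallyConnected (G : Subgroup (CrDiffeo n r M)) : Prop :=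
  ∀ g ∈ G, ∃ f : ℝ → CrDiffeo n r M, IsIsotopyIn G f ∧ IsCompactlySupported f ∧ f 1 = g

variable (n r M) in
/-- The class `𝔊^r(M)` of isotopically connected groups of `C^r` diffeomorphisms. -/
abbrev IsotopicGroups : Type u :=
  {G : Subgroup (CrDiffeo n r M) // IsotopicallyConnected G}

variable (n r M) in
/-- The class `𝔊^r_c(M)` of groups of `C^r` diffeomorphisms that are isotopically connected through
compactly supported isotopies. -/
abbrev CompactIsotopicGroups : Type u :=
  {G : Subgroup (CrDiffeo n r M) // CompactlyIsotopicallyConnected G}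

/-- The inclusion of `𝔊^r_c(M)` in `𝔊^r(M)`. -/
def CompactIsotopicGroups.toIsotopicGroups (G : CompactIsotopicGroups n r M) :
    IsotopicGroups n r M :=
  ⟨G.1, fun g hg => by
    obtain ⟨f, hf, -, h1⟩ := G.2 g hg
    exact ⟨f, hf, h1⟩⟩

/-- For a group `H` of diffeomorphisms, the subgroup `H_{c,0}` of those elements that can be joined
to the identity through a compactly supported `C^r` isotopy in `H`. -/
def compactIdentityComponent (H : Subgroup (CrDiffeo n r M)) : Subgroup (CrDiffeo n r M) where
  carrier := {g | ∃ f : ℝ → CrDiffeo n r M, IsIsotopyIn H f ∧ IsCompactlySupported f ∧ f 1 = g}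
  mul_mem' := by
    rintro _ _ ⟨f, hf, ⟨K, hK, hfK⟩, rfl⟩ ⟨g, hg, ⟨L, hL, hgL⟩, rfl⟩
    refine ⟨fun t => f t * g t, ⟨?_, ?_, fun t => H.mul_mem (hf.mem t) (hg.mem t)⟩,
      ⟨K ∪ L, hK.union hL, fun t x hx => ?_⟩, rfl⟩
    · exact hf.contMDiff.comp (contMDiff_fst.prodMk hg.contMDiff)
    · simp [hf.zero, hg.zero]
    · rw [mul_apply, hgL t x fun h => hx (Or.inr h), hfK t x fun h => hx (Or.inl h)]
  one_mem' := ⟨fun _ => 1, ⟨contMDiff_snd, rfl, fun _ => H.one_mem⟩,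
    ⟨∅, isCompact_empty, fun _ _ _ => rfl⟩, rfl⟩
  inv_mem' := by
    rintro _ ⟨f, hf, ⟨K, hK, hfK⟩, rfl⟩
    refine ⟨fun t => f (1 - t) * (f 1)⁻¹,
      ⟨?_, ?_, fun t => H.mul_mem (hf.mem _) (H.inv_mem (hf.mem 1))⟩,
      ⟨K, hK, fun t x hx => ?_⟩, ?_⟩
    · have h1 : ContMDiff 𝓘(ℝ, ℝ) 𝓘(ℝ, ℝ) r (fun t : ℝ => 1 - t) :=
        (contDiff_const.sub contDiff_id).contMDiff
      exact hf.contMDiff.comp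
        ((h1.comp contMDiff_fst).prodMk ((f 1)⁻¹.contMDiff.comp contMDiff_snd))
    · simp
    · have h : (f 1)⁻¹ x = x := by
        conv_lhs => rw [← hfK 1 x hx]
        exact inv_apply_self _ _
      rw [mul_apply, h, hfK _ x hx]
    · simp [hf.zero]

/-- `H_{c,0}` is isotopically connected through compactly supported isotopies. -/
theorem compactlyIsotopicallyConnected_compactIdentityComponent
    (H : Subgroup (CrDiffeo n r M)) :
    CompactlyIsotopicallyConnected (compactIdentityComponent H) := by
  rintro _ ⟨f, hf, ⟨K, hK, hfK⟩, rfl⟩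
  refine ⟨f, ⟨hf.contMDiff, hf.zero, fun t => ?_⟩, ⟨K, hK, hfK⟩, rfl⟩
  refine ⟨fun s => f (s * t), ⟨?_, ?_, fun s => hf.mem _⟩, ⟨K, hK, fun s => hfK _⟩, ?_⟩
  · have h1 : ContMDiff 𝓘(ℝ, ℝ) 𝓘(ℝ, ℝ) r (fun s : ℝ => s * t) :=
      (contDiff_id.mul contDiff_const).contMDiff
    exact hf.contMDiff.comp ((h1.comp contMDiff_fst).prodMk contMDiff_snd)
  · simp [hf.zero]
  · simp

/-! ### Foliations -/

variable (n r) in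
/-- `L` is a connected weakly imbedded `k`-dimensional submanifold of class `C^r` of `M`. The
differentiable structure on `L` is given by a `k`-dimensional `C^r` manifold `P` and a bijection
`i` of `P` onto `L`. As a map to `M`, `i` is an immersion; and a map `f` from a locally connected
space to `L` which is continuous as a map to `M` is continuous for the topology of `P`. -/
def IsWeaklyImbedded (k : ℕ) (L : Set M) : Prop :=
  ∃ (P : Type u) (_ : TopologicalSpace P) (_ : ChartedSpace (EuclideanSpace ℝ (Fin k)) P)
    (_ : IsManifold (𝓡 k) r P) (_ : ConnectedSpace P) (i : P → M),
    Injective i ∧ range i = L ∧ Manifold.IsImmersion (𝓡 k) (𝓡 n) r i ∧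
    ∀ (N : Type u) [TopologicalSpace N] [LocallyConnectedSpace N] (f : N → P),
      Continuous (i ∘ f) → Continuous f

variable (n r) in
/-- The partition `leaves` of `M` has at `x` a distinguished chart for a `k`-dimensional leaf: a
`C^r` chart `φ` of `M` on a neighbourhood `U` of `x`, with `φ x = 0` and `φ U = V × W`, such that
`φ (L ∩ U) = V × {w ∈ W | φ⁻¹ (0, w) ∈ L}` for every leaf `L`. -/
def HasDistinguishedChart (leaves : Set (Set M)) (k : ℕ) (x : M) : Prop :=
  ∃ (φ : OpenPartialHomeomorph M
        (EuclideanSpace ℝ (Fin k) × EuclideanSpace ℝ (Fin (n - k))))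
    (V : Set (EuclideanSpace ℝ (Fin k))) (W : Set (EuclideanSpace ℝ (Fin (n - k)))),
    ContMDiffOn (𝓡 n) 𝓘(ℝ, EuclideanSpace ℝ (Fin k) × EuclideanSpace ℝ (Fin (n - k))) r
      φ φ.source ∧
    ContMDiffOn 𝓘(ℝ, EuclideanSpace ℝ (Fin k) × EuclideanSpace ℝ (Fin (n - k))) (𝓡 n) r
      φ.symm φ.target ∧
    x ∈ φ.source ∧ φ x = 0 ∧ IsOpen V ∧ IsOpen W ∧ φ.target = V ×ˢ W ∧
    ∀ L ∈ leaves, φ '' (L ∩ φ.source) = V ×ˢ {w ∈ W | φ.symm (0, w) ∈ L}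

variable (n r M) in
/-- The class `𝔉^r(M)` of (singular) foliations of class `C^r` of `M`: partitions of `M` into
connected weakly imbedded submanifolds with distinguished charts at all points. -/
@[ext]
structure Foliation where
  leaves : Set (Set M)
  isPartition : Setoid.IsPartition leaves
  exists_dim : ∀ L ∈ leaves, ∃ k : ℕ, IsWeaklyImbedded n r k L ∧
    ∀ x ∈ L, HasDistinguishedChart n r leaves k x

/-- The group `Diff^r(M, F)` of leaf preserving `C^r` diffeomorphisms. -/
def Foliation.leafPreserving (F : Foliation n r M) : Subgroup (CrDiffeo n r M) where
  carrier := {f | ∀ L ∈ F.leaves, f '' L = L}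
  mul_mem' := by
    intro f g hf hg L hL
    have h : ((f * g : CrDiffeo n r M) : M → M) = f ∘ g := rfl
    rw [h, image_comp, hg L hL, hf L hL]
  one_mem' := fun L _ => image_id L
  inv_mem' := by
    intro f hf L hL
    conv_lhs => rw [← hf L hL]
    rw [← image_comp]
    have h : ((f⁻¹ : CrDiffeo n r M) : M → M) ∘ f = id := funext fun x => inv_apply_self f x
    rw [h, image_id]

/-- The map `α_M : 𝔉^r(M) → 𝔊^r_c(M)` which sends `F` to `G_F = Diff^r_c(M, F)_0`. -/
def alpha (F : Foliation n r M) : CompactIsotopicGroups n r M :=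
  ⟨compactIdentityComponent F.leafPreserving,
    compactlyIsotopicallyConnected_compactIdentityComponent _⟩

/-! ### Arrows and accessible sets -/

variable (n r M) in
/-- A `C^r`-arrow: a `C^r` map from an open subset `dom` of `ℝ × M` to `M` (the values of `toFun`
outside `dom` are irrelevant). -/
structure Arrow where
  dom : Set (ℝ × M)
  toFun : ℝ × M → M
  isOpen_dom : IsOpen dom
  contMDiffOn : ContMDiffOn (𝓘(ℝ, ℝ).prod (𝓡 n)) (𝓡 n) r toFun dom
  /-- Each `φ_t` is a `C^r` diffeomorphism of an open set onto an open set. -/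
  localDiffeo : ∀ t : ℝ, ∃ ψ : OpenPartialHomeomorph M M,
    ψ.source = {x | (t, x) ∈ dom} ∧ EqOn ψ (fun x => toFun (t, x)) ψ.source ∧
    ContMDiffOn (𝓡 n) (𝓡 n) r ψ ψ.source ∧ ContMDiffOn (𝓡 n) (𝓡 n) r ψ.symm ψ.target
  zero : ∀ x, (0, x) ∈ dom → toFun (0, x) = x
  anti : ∀ s t : ℝ, 0 ≤ s → s < t → {x | (t, x) ∈ dom} ⊆ {x | (s, x) ∈ dom}

/-- `𝒜*`: the local diffeomorphisms `φ_t` with `φ ∈ 𝒜` and `t ∈ ℝ`. -/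
def arrowStar (A : Set (Arrow n r M)) : Set (OpenPartialHomeomorph M M) :=
  {ψ | ∃ φ ∈ A, ∃ t : ℝ, ψ.source = {x | (t, x) ∈ φ.dom} ∧
    EqOn ψ (fun x => φ.toFun (t, x)) ψ.source}

/-- The finite compositions of elements of `𝒜*` and of `(𝒜*)⁻¹`, and the identity. -/
inductive ArrowHat (A : Set (Arrow n r M)) : OpenPartialHomeomorph M M → Prop
  | refl : ArrowHat A (OpenPartialHomeomorph.refl M)
  | step {ψ χ : OpenPartialHomeomorph M M} :
      ArrowHat A ψ → χ ∈ arrowStar A → ArrowHat A (ψ.trans χ)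
  | step_inv {ψ χ : OpenPartialHomeomorph M M} :
      ArrowHat A ψ → χ ∈ arrowStar A → ArrowHat A (ψ.trans χ.symm)

/-- The accessible set of `𝒜` through `x`: the orbit of `x` under these compositions. -/
def accessibleSet (A : Set (Arrow n r M)) (x : M) : Set M :=
  {y | ∃ ψ : OpenPartialHomeomorph M M, ArrowHat A ψ ∧ x ∈ ψ.source ∧ ψ x = y}

/-- `𝒜_G`: the arrows which are restrictions of isotopies in `G` to open subsets of `ℝ × M`. -/
def isotopyArrows (G : Subgroup (CrDiffeo n r M)) : Set (Arrow n r M) :=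
  {φ | ∃ f : ℝ → CrDiffeo n r M, IsIsotopyIn G f ∧
    EqOn φ.toFun (fun p => f p.1 p.2) φ.dom}

/-- The map `β_M` which sends `G ∈ 𝔊^r(M)` to `F_G`, the partition of `M` into the accessible sets
of `𝒜_G`. The differentiable structure of a weakly imbedded submanifold is unique, so a foliation
is given by its set of leaves. -/
def beta (G : IsotopicGroups n r M) : Set (Set M) :=
  range (accessibleSet (isotopyArrows G.1))

end Manifold

end StefanFoliation

open scoped Topology NNReal

namespace StefanFoliation

universe u

/-! The accessible sets of the isotopies in an isotopically connected group are its orbits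
(`accessibleSet_isotopyArrows`), so the claim is that the orbits of `G_F` are the leaves. Elements
of `G_F` preserve leaves, hence only transitivity on a leaf needs work
(`exists_mem_alpha_of_mem_leaf`).

In a distinguished chart at `x`, a short translation along the plaque, cut off by a bump function,
is the end of a compactly supported leaf preserving isotopy. The orbit of `x` therefore contains the
plaque near `x` (`exists_mem_alpha_apply_eq`). This plaque must be a neighbourhood of `x` in the
intrinsic topology of the leaf. Weak imbedding makes its parametrization continuous into the leaf,
and equality of dimensions then makes it open at the centre (`map_nhds_eq_of_isImmersionAt`). Orbits
are thus open in the leaf, which is connected, so there is only one.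

Injectivity follows because the leaves are recovered from `G_F`. -/

/-! ### Translations with compact support -/

/-- A `C^r` perturbation of the identity by a strict contraction is a `C^r` diffeomorphism. -/
theorem exists_homeomorph_id_add {E : Type*} [NormedAddCommGroup E] [NormedSpace ℝ E]
    [CompleteSpace E] {r : ℕ∞ω} (hr : 1 ≤ r) {h : E → E} (hh : ContDiff ℝ r h) {c : ℝ≥0}
    (hc : c < 1) (hL : LipschitzWith c h) :
    ∃ Φ : E ≃ₜ E, (∀ z, Φ z = z + h z) ∧ ContDiff ℝ r Φ.symm := by
  have happ : ApproximatesLinearOn (fun z => z + h z)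
      ((ContinuousLinearEquiv.refl ℝ E : E ≃L[ℝ] E) : E →L[ℝ] E) univ c := by
    intro x _ y _
    have : x + h x - (y + h y) - (x - y) = h x - h y := by abel
    simpa [this] using hL.norm_sub_le x y
  -- On the zero space the identity has norm `0` and the strict inequality fails, hence the separate
  -- case.
  have hc' : Subsingleton E ∨
      c < ‖((ContinuousLinearEquiv.refl ℝ E).symm : E →L[ℝ] E)‖₊⁻¹ := by
    rcases subsingleton_or_nontrivial E with hE | hE
    · exact Or.inl hE
    · refine Or.inr ?_
      have : ‖((ContinuousLinearEquiv.refl ℝ E).symm : E →L[ℝ] E)‖₊ = 1 :=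
        ContinuousLinearMap.nnnorm_id
      rw [this, inv_one]
      exact hc
  have hd : Differentiable ℝ h := hh.differentiable (by positivity)
  -- The derivative is inverted by a Neumann series; this is what makes the inverse homeomorphism
  -- `C^r`.
  have hu : ∀ z, IsUnit (1 + fderiv ℝ h z) := fun z => by
    have hn : ‖-fderiv ℝ h z‖ < 1 := by
      rw [norm_neg]
      exact (norm_fderiv_le_of_lipschitz ℝ hL).trans_lt (by exact_mod_cast hc)
    simpa using isUnit_one_sub_of_norm_lt_one hn
  refine ⟨happ.toHomeomorph _ hc', fun z => rfl, ?_⟩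
  refine Homeomorph.contDiff_symm (f₀' := fun z => ContinuousLinearEquiv.ofUnit (hu z).unit)
    _ (fun z => ?_) (contDiff_id.add hh)
  exact (hasFDerivAt_id z).add (hd z).hasFDerivAt

theorem exists_contDiff_bump {E : Type*} [NormedAddCommGroup E] [NormedSpace ℝ E]
    [FiniteDimensional ℝ E] (r : ℕ∞) {ε : ℝ} (hε : 0 < ε) :
    ∃ b : E → ℝ, ContDiff ℝ r b ∧ HasCompactSupport b ∧ b 0 = 1 ∧
      ∀ z ∉ Metric.closedBall (0 : E) ε, b z = 0 := by
  let b : ContDiffBump (0 : E) := ⟨ε / 2, ε, by positivity, by linarith⟩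
  refine ⟨b, b.contDiff, b.hasCompactSupport,
    b.one_of_mem_closedBall (Metric.mem_closedBall_self b.rIn_pos.le), fun z hz => ?_⟩
  exact b.zero_of_le_dist (not_le.1 fun h => hz (Metric.mem_closedBall.2 h)).le

/-- The maps `z ↦ z + σ(t) b(z) u`, for `|σ| ≤ 1` and a function `b` with small Lipschitz constant. -/
theorem exists_isotopy_add_smul {E : Type*} [NormedAddCommGroup E] [NormedSpace ℝ E]
    [CompleteSpace E] {r : ℕ∞ω} (hr : 1 ≤ r) {σ : ℝ → ℝ} (hσ : ContDiff ℝ r σ)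
    (hσ1 : ∀ t, |σ t| ≤ 1) {b : E → ℝ} (hb : ContDiff ℝ r b) {C : ℝ≥0}
    (hC : LipschitzWith C b) {u : E} (hu : C * ‖u‖₊ < 1) :
    ∃ Φ : ℝ → E ≃ₜ E, ContDiff ℝ r (fun p : ℝ × E => Φ p.1 p.2) ∧
      (∀ t, ContDiff ℝ r (Φ t).symm) ∧
      ∀ t z, Φ t z = z + (σ t * b z) • u := by
  have hh : ContDiff ℝ r (fun p : ℝ × E => (σ p.1 * b p.2) • u) :=
    ((hσ.comp contDiff_fst).mul (hb.comp contDiff_snd)).smul contDiff_const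
  have hL : ∀ t, LipschitzWith (C * ‖u‖₊)
      (fun z => (σ t * b z) • u) := fun t => by
    refine LipschitzWith.of_dist_le_mul fun x y => ?_
    have h3 : |b x - b y| ≤ C * dist x y := by simpa [Real.dist_eq] using hC.dist_le_mul x y
    rw [dist_eq_norm, ← sub_smul, ← mul_sub, norm_smul, Real.norm_eq_abs, abs_mul]
    calc _ ≤ 1 * (C * dist x y) * ‖u‖ := by
          gcongr
          exact hσ1 t
      _ = _ := by push_cast; ring
  have key : ∀ t : ℝ, ∃ Φ : E ≃ₜ E,
      (∀ z, Φ z = z + (σ t * b z) • u) ∧ ContDiff ℝ r Φ.symm :=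
    fun t => exists_homeomorph_id_add hr (hh.comp (contDiff_const.prodMk contDiff_id)) hu (hL t)
  choose Φ hΦ hΦs using key
  refine ⟨Φ, ?_, hΦs, hΦ⟩
  simp only [hΦ]
  exact contDiff_snd.add hh

/-- Short translations of a vector space are ends of isotopies supported near the origin which move
points along the translation vector only. -/
theorem exists_translation_isotopy {E : Type*} [NormedAddCommGroup E] [NormedSpace ℝ E]
    [FiniteDimensional ℝ E] {r : ℕ∞} (hr : 1 ≤ r) {T : Set E} (hT : T ∈ 𝓝 0) :
    ∃ K ⊆ T, IsCompact K ∧ ∃ δ > 0, ∀ u : E, ‖u‖ < δ → ∃ Φ : ℝ → E ≃ₜ E,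
      ContDiff ℝ r (fun p : ℝ × E => Φ p.1 p.2) ∧ (∀ t, ContDiff ℝ r (Φ t).symm) ∧
      (∀ z, Φ 0 z = z) ∧ (∀ t, ∀ z ∉ K, Φ t z = z) ∧
      (∀ t z, ∃ a : ℝ, Φ t z = z + a • u) ∧ Φ 1 0 = u := by
  have : CompleteSpace E := FiniteDimensional.complete ℝ E
  have : ProperSpace E := FiniteDimensional.proper ℝ E
  obtain ⟨ε, hε, hεT⟩ := Metric.nhds_basis_closedBall.mem_iff.1 hT
  obtain ⟨b, hb, hbs, hb0, hbε⟩ := exists_contDiff_bump (E := E) r hε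
  have hr' : (1 : ℕ∞ω) ≤ r := by exact_mod_cast hr
  obtain ⟨C, hC⟩ := hb.lipschitzWith_of_hasCompactSupport hbs (zero_lt_one.trans_le hr').ne'
  -- The bound `1 / (C + 1)` gives `C * ‖u‖ < 1` and makes sense also for `C = 0`.
  refine ⟨Metric.closedBall 0 ε, hεT, isCompact_closedBall _ _, 1 / (C + 1), by positivity,
    fun u hu => ?_⟩
  have hc : C * ‖u‖₊ < 1 := by
    have h1 : ‖u‖ * (C + 1) < 1 := (lt_div_iff₀ (by positivity)).1 hu
    have h2 := norm_nonneg u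
    rw [← NNReal.coe_lt_coe]
    push_cast
    nlinarith
  -- A time function that is `0` at `0`, `1` at `1`, and bounded by `1` on all of `ℝ`, so that the
  -- contraction bound holds at every time.
  have hσ : ContDiff ℝ r (fun t => Real.sin (t * (Real.pi / 2))) :=
    Real.contDiff_sin.comp (contDiff_id.mul contDiff_const)
  obtain ⟨Φ, hΦ, hΦs, h⟩ := exists_isotopy_add_smul hr' hσ
    (fun t => Real.abs_sin_le_one _) hb hC hc
  refine ⟨Φ, hΦ, hΦs, fun z => ?_, fun t z hz => ?_, fun t z => ⟨_, h t z⟩, ?_⟩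
  · simp [h]
  · simp [h, hbε z hz]
  · simp [h, hb0]

/-! ### Transport of diffeomorphisms through a chart -/

open Classical in
/-- The map `f`, read in the chart `φ`, extended by the identity outside the chart domain. -/
noncomputable def chartExtend {M E : Type*} [TopologicalSpace M] [TopologicalSpace E]
    (φ : OpenPartialHomeomorph M E) (f : E → E) (x : M) : M :=
  if x ∈ φ.source then φ.symm (f (φ x)) else x

section ChartExtend

variable {M E : Type*} [TopologicalSpace M] [TopologicalSpace E] {φ : OpenPartialHomeomorph M E}
  {x : M}

theorem chartExtend_of_mem (hx : x ∈ φ.source) (f : E → E) :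
    chartExtend φ f x = φ.symm (f (φ x)) := if_pos hx

theorem chartExtend_of_notMem (hx : x ∉ φ.source) (f : E → E) : chartExtend φ f x = x := if_neg hx

theorem chartExtend_eq_self {K : Set E} {f : E → E} (hf : ∀ z ∉ K, f z = z)
    (hx : x ∉ φ.symm '' K) : chartExtend φ f x = x := by
  by_cases h : x ∈ φ.source
  · rw [chartExtend_of_mem h, hf _ fun hK => hx ⟨_, hK, φ.left_inv h⟩, φ.left_inv h]
  · exact chartExtend_of_notMem h f

theorem chartExtend_chartExtend {f g : E → E} (hf : MapsTo f φ.target φ.target)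
    (hgf : LeftInverse g f) (x : M) : chartExtend φ g (chartExtend φ f x) = x := by
  by_cases h : x ∈ φ.source
  · have h1 := hf (φ.map_source h)
    rw [chartExtend_of_mem h, chartExtend_of_mem (φ.map_target h1), φ.right_inv h1, hgf,
      φ.left_inv h]
  · rw [chartExtend_of_notMem h, chartExtend_of_notMem h]

-- If `f z ∉ K`, then `f` fixes `f z`, and injectivity gives `f z = z`.
omit [TopologicalSpace E] in
theorem mapsTo_of_eq_self_off {K T : Set E} (hKT : K ⊆ T) {f : E → E} (hf : ∀ z ∉ K, f z = z)
    (hi : Injective f) : MapsTo f T T := by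
  intro z hz
  by_cases h : f z ∈ K
  · exact hKT h
  · rwa [hi (hf _ h)]

end ChartExtend

section Diffeo

variable {n : ℕ} {r : ℕ∞ω} {M : Type u} [TopologicalSpace M] [T2Space M]
  [ChartedSpace (EuclideanSpace ℝ (Fin n)) M]
  {E : Type*} [NormedAddCommGroup E] [NormedSpace ℝ E] {φ : OpenPartialHomeomorph M E} {K : Set E}

/-- Since `M` is Hausdorff, the compact set `φ.symm '' K` is closed. Its complement, where the map
is the identity, and the chart domain form an open cover of `M`. -/
theorem contMDiff_chartExtend (hφ : ContMDiffOn (𝓡 n) 𝓘(ℝ, E) r φ φ.source)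
    (hφ' : ContMDiffOn 𝓘(ℝ, E) (𝓡 n) r φ.symm φ.target) (hK : IsCompact K)
    (hKφ : K ⊆ φ.target) {F : ℝ → E → E} (hF : ContDiff ℝ r (fun p : ℝ × E => F p.1 p.2))
    (hFφ : ∀ t, MapsTo (F t) φ.target φ.target) (hFK : ∀ t, ∀ z ∉ K, F t z = z) :
    ContMDiff (𝓘(ℝ, ℝ).prod (𝓡 n)) (𝓡 n) r (fun p : ℝ × M => chartExtend φ (F p.1) p.2) := by
  intro p
  by_cases hp : p.2 ∈ φ.source
  · have h1 : ContMDiffOn (𝓘(ℝ, ℝ).prod (𝓡 n)) (𝓡 n) r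
        (fun p : ℝ × M => φ.symm (F p.1 (φ p.2))) (Prod.snd ⁻¹' φ.source) := by
      refine hφ'.comp ?_ fun q hq => hFφ _ (φ.map_source hq)
      exact hF.contMDiff.comp_contMDiffOn
        (contMDiffOn_fst.prodMk_space (hφ.comp contMDiffOn_snd fun q hq => hq))
    have h2 : Prod.snd ⁻¹' φ.source ∈ 𝓝 p :=
      (φ.open_source.preimage continuous_snd).mem_nhds hp
    refine (h1.contMDiffAt h2).congr_of_eventuallyEq ?_
    filter_upwards [h2] with q hq using chartExtend_of_mem hq _
  · have h1 : IsClosed (φ.symm '' K) :=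
      (hK.image_of_continuousOn (φ.continuousOn_symm.mono hKφ)).isClosed
    have h2 : p.2 ∉ φ.symm '' K := by
      rintro ⟨z, hz, h⟩
      exact hp (h ▸ φ.map_target (hKφ hz))
    refine contMDiffAt_snd.congr_of_eventuallyEq ?_
    filter_upwards [(h1.isOpen_compl.preimage continuous_snd).mem_nhds h2] with q hq
    exact chartExtend_eq_self (hFK _) hq

/-- A diffeomorphism of the model space supported in a chart, as a diffeomorphism of `M`. -/
theorem exists_diffeo_chartExtend (hφ : ContMDiffOn (𝓡 n) 𝓘(ℝ, E) r φ φ.source)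
    (hφ' : ContMDiffOn 𝓘(ℝ, E) (𝓡 n) r φ.symm φ.target) (hK : IsCompact K)
    (hKφ : K ⊆ φ.target) {Φ : E ≃ₜ E} (hΦ : ContDiff ℝ r Φ) (hΦs : ContDiff ℝ r Φ.symm)
    (hΦK : ∀ z ∉ K, Φ z = z) :
    ∃ f : CrDiffeo n r M, ⇑f = chartExtend φ Φ ∧ ⇑f⁻¹ = chartExtend φ Φ.symm := by
  have hΦsK : ∀ z ∉ K, Φ.symm z = z := fun z hz => by rw [Φ.symm_apply_eq, hΦK z hz]
  have h1 := mapsTo_of_eq_self_off hKφ hΦK Φ.injective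
  have h2 := mapsTo_of_eq_self_off hKφ hΦsK Φ.symm.injective
  have key : ∀ {g : E → E}, ContDiff ℝ r g → MapsTo g φ.target φ.target → (∀ z ∉ K, g z = z) →
      ContMDiff (𝓡 n) (𝓡 n) r (chartExtend φ g) := fun {g} hg hgφ hgK =>
    (contMDiff_chartExtend hφ hφ' hK hKφ (F := fun _ => g) (hg.comp contDiff_snd)
      (fun _ => hgφ) fun _ => hgK).comp ((contMDiff_const (c := (0 : ℝ))).prodMk contMDiff_id)
  exact ⟨⟨⟨chartExtend φ Φ, chartExtend φ Φ.symm, chartExtend_chartExtend h1 Φ.symm_apply_apply,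
    chartExtend_chartExtend h2 Φ.apply_symm_apply⟩, key hΦ h1 hΦK, key hΦs h2 hΦsK⟩, rfl, rfl⟩

end Diffeo

/-! ### Immersions of the same dimension as a smooth slice -/

/-- A continuous lift `j` through an immersion `i` of a `C^r` parametrized slice `c` of the dimension
of the source of `i` is open. -/
theorem map_nhds_eq_of_isImmersionAt {n k : ℕ} {r : ℕ∞ω} (hr : 1 ≤ r) {M P : Type*}
    [TopologicalSpace M] [ChartedSpace (EuclideanSpace ℝ (Fin n)) M] [IsManifold (𝓡 n) r M]
    [TopologicalSpace P] [ChartedSpace (EuclideanSpace ℝ (Fin k)) P] {i : P → M} {p : P}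
    (hi : Manifold.IsImmersionAt (𝓡 k) (𝓡 n) r i p) {c : EuclideanSpace ℝ (Fin k) → M}
    (hc : ContMDiffAt (𝓡 k) (𝓡 n) r c 0) {ρ : M → EuclideanSpace ℝ (Fin k)}
    (hρ : ContMDiffAt (𝓡 n) (𝓡 k) r ρ (c 0)) (hρc : ∀ᶠ v in 𝓝 0, ρ (c v) = v)
    {j : EuclideanSpace ℝ (Fin k) → P} (hj : ContinuousAt j 0) (hj0 : j 0 = p)
    (hij : ∀ᶠ v in 𝓝 0, i (j v) = c v) : Filter.map j (𝓝 0) = 𝓝 p := by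
  obtain ⟨F, _, _, hF⟩ := hi
  set d := hF.domChart
  set e := hF.codChart
  set A := hF.equiv
  have hp : p ∈ d.source := hF.mem_domChart_source
  have hie : ∀ q ∈ d.source, i q ∈ e.source := hF.mapsto_domChart_source_codChart_source
  -- The first component of `A.symm` recovers `d q` from `e (i q)`; hence the lift `j`, only assumed
  -- continuous, is of class `C^r` at `0`.
  have hei : ∀ q ∈ d.source, e (i q) = A (d q, 0) := fun q hq => by
    have hdq : d q ∈ (d.extend (𝓡 k)).target := by simpa using d.map_source hq
    have h : e (i (d.symm (d q))) = A (d q, 0) := hF.writtenInCharts hdq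
    rwa [d.left_inv hq] at h
  have hc0 : c 0 = i p := by rw [← hij.self_of_nhds, hj0]
  have hjd : ∀ᶠ v in 𝓝 0, j v ∈ d.source :=
    hj.eventually_mem (d.open_source.mem_nhds (hj0.symm ▸ hp))
  have he : ContMDiffAt (𝓡 n) (𝓡 n) r e (i p) :=
    contMDiffAt_of_mem_maximalAtlas hF.codChart_mem_maximalAtlas (hie p hp)
  have hes : ContMDiffAt (𝓡 n) (𝓡 n) r e.symm (e (i p)) :=
    contMDiffAt_symm_of_mem_maximalAtlas hF.codChart_mem_maximalAtlas (e.map_source (hie p hp))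
  -- `j` read in the chart of the immersion
  have hg : ContDiffAt ℝ r (d ∘ j) 0 := by
    have hA : ContDiff ℝ r fun y => (A.symm y).1 := contDiff_fst.comp A.symm.contDiff
    have h1 : ContMDiffAt (𝓡 k) (𝓡 k) r (fun v => (A.symm (e (c v))).1) 0 :=
      hA.contMDiff.contMDiffAt.comp 0 (ContMDiffAt.comp 0 (hc0 ▸ he) hc)
    refine h1.contDiffAt.congr_of_eventuallyEq ?_
    filter_upwards [hij, hjd] with v hv hvd
    simp [← hv, hei _ hvd]
  -- This map, `ρ ∘ i` read in the chart `d`, is a left inverse of `d ∘ j` near `0`.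
  have hs : ContDiffAt ℝ r (fun q => ρ (e.symm (A (q, 0)))) (d (j 0)) := by
    have hA : ContDiff ℝ r fun q => A (q, 0) := A.contDiff.comp (contDiff_id.prodMk contDiff_const)
    have h0 : A (d (j 0), 0) = e (i p) := by rw [hj0, hei p hp]
    have h2 : e.symm (e (i p)) = c 0 := by rw [e.left_inv (hie p hp), hc0]
    have h1 : ContMDiffAt (𝓡 n) (𝓡 k) r (ρ ∘ e.symm) (A (d (j 0), 0)) := by
      rw [h0]
      exact ContMDiffAt.comp _ (h2 ▸ hρ) hes
    exact (ContMDiffAt.comp (d (j 0)) h1 hA.contMDiff.contMDiffAt).contDiffAt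
  have hsg : (fun q => ρ (e.symm (A (q, 0)))) ∘ (d ∘ j) =ᶠ[𝓝 0] id := by
    filter_upwards [hij, hjd, hρc] with v hv hvd hvρ
    simp only [comp_apply, id]
    rw [← hei _ hvd, e.left_inv (hie _ hvd), hv, hvρ]
  have hr0 : r ≠ 0 := (zero_lt_one.trans_le hr).ne'
  have hd1 := (hs.differentiableAt hr0).hasFDerivAt.comp (0 : EuclideanSpace ℝ (Fin k))
    (hg.differentiableAt hr0).hasFDerivAt
  have hd2 := hd1.unique ((hasFDerivAt_id _).congr_of_eventuallyEq hsg)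
  have hinj : Injective (fderiv ℝ (d ∘ j) 0) :=
    LeftInverse.injective (g := fderiv ℝ (fun q => ρ (e.symm (A (q, 0)))) (d (j 0)))
      fun v => congrArg (fun f => f v) hd2
  -- Equality of dimensions enters here: both sides are `k`-dimensional.
  have hsurj : (fderiv ℝ (d ∘ j) 0).range = ⊤ :=
    LinearMap.range_eq_top.2 (LinearMap.injective_iff_surjective.1 hinj)
  have hmap := (hg.hasStrictFDerivAt hr0).map_nhds_eq_of_surj hsurj
  have hjg : j =ᶠ[𝓝 0] d.symm ∘ (d ∘ j) := by
    filter_upwards [hjd] with v hv using (d.left_inv hv).symm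
  rw [Filter.map_congr hjg, ← Filter.map_map, hmap, comp_apply, hj0,
    d.symm.map_nhds_eq (d.map_source hp), d.left_inv hp]

section Leaves

variable {n : ℕ} {M : Type u} [TopologicalSpace M] [ChartedSpace (EuclideanSpace ℝ (Fin n)) M]

/-! ### Orbits of `G_F` -/

/-- A map of a distinguished chart along the plaques preserves the leaves. -/
theorem mapsTo_chartExtend_of_snd_eq {E₁ E₂ : Type*} [TopologicalSpace E₁] [TopologicalSpace E₂]
    [Zero E₁] {φ : OpenPartialHomeomorph M (E₁ × E₂)} {V : Set E₁} {W : Set E₂} {L : Set M}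
    (hφ : φ.target = V ×ˢ W)
    (hL : φ '' (L ∩ φ.source) = V ×ˢ {w ∈ W | φ.symm (0, w) ∈ L}) {f : E₁ × E₂ → E₁ × E₂}
    (hf : MapsTo f φ.target φ.target) (hf2 : ∀ z, (f z).2 = z.2) :
    MapsTo (chartExtend φ f) L L := by
  intro x hx
  by_cases h : x ∈ φ.source
  · have h1 : φ x ∈ V ×ˢ {w ∈ W | φ.symm (0, w) ∈ L} := hL ▸ mem_image_of_mem φ ⟨hx, h⟩
    have h2 := hf (φ.map_source h)
    rw [hφ] at h2
    have h3 : f (φ x) ∈ φ '' (L ∩ φ.source) := by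
      rw [hL]
      refine ⟨h2.1, ?_⟩
      rw [hf2]
      exact h1.2
    obtain ⟨y, ⟨hyL, hy⟩, hyf⟩ := h3
    rwa [chartExtend_of_mem h, ← hyf, φ.left_inv hy]
  · rwa [chartExtend_of_notMem h]

/-- The plaque through the centre of a distinguished chart is, near the centre, in one orbit of
`G_F`. -/
theorem exists_mem_alpha_apply_eq [T2Space M] {r : ℕ∞} (hr : 1 ≤ r) (F : Foliation n r M)
    {k m : ℕ} {φ : OpenPartialHomeomorph M (EuclideanSpace ℝ (Fin k) × EuclideanSpace ℝ (Fin m))}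
    {V : Set (EuclideanSpace ℝ (Fin k))} {W : Set (EuclideanSpace ℝ (Fin m))} {x : M}
    (hφ : ContMDiffOn (𝓡 n) 𝓘(ℝ, EuclideanSpace ℝ (Fin k) × EuclideanSpace ℝ (Fin m)) r
      φ φ.source)
    (hφ' : ContMDiffOn 𝓘(ℝ, EuclideanSpace ℝ (Fin k) × EuclideanSpace ℝ (Fin m)) (𝓡 n) r
      φ.symm φ.target)
    (hx : x ∈ φ.source) (hx0 : φ x = 0) (hVW : φ.target = V ×ˢ W)
    (hL : ∀ L ∈ F.leaves, φ '' (L ∩ φ.source) = V ×ˢ {w ∈ W | φ.symm (0, w) ∈ L}) :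
    ∀ᶠ v in 𝓝 0, ∃ g ∈ (alpha F).1, g x = φ.symm (v, 0) := by
  have hT : φ.target ∈ 𝓝 0 := φ.open_target.mem_nhds (hx0 ▸ φ.map_source hx)
  obtain ⟨K, hKφ, hK, δ, hδ, H⟩ := exists_translation_isotopy hr hT
  filter_upwards [Metric.ball_mem_nhds 0 hδ] with v hv
  -- The translation vector has zero transverse component, so every `Φ t` moves points along
  -- plaques.
  obtain ⟨Φ, hΦ, hΦs, hΦ0, hΦK, hΦv, hΦ1⟩ := H (v, 0) (by simpa [Prod.norm_def, hδ] using hv)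
  have hΦ2 : ∀ t z, (Φ t z).2 = z.2 := fun t z => by
    obtain ⟨a, ha⟩ := hΦv t z
    simp [ha]
  have hΦs2 : ∀ t z, ((Φ t).symm z).2 = z.2 := fun t z => by
    rw [← hΦ2 t, (Φ t).apply_symm_apply]
  have hΦsK : ∀ t, ∀ z ∉ K, (Φ t).symm z = z := fun t z hz => by
    rw [(Φ t).symm_apply_eq, hΦK t z hz]
  have hΦφ := fun t => mapsTo_of_eq_self_off hKφ (hΦK t) (Φ t).injective
  have hΦsφ := fun t => mapsTo_of_eq_self_off hKφ (hΦsK t) (Φ t).symm.injective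
  choose f hf hfs using fun t => exists_diffeo_chartExtend hφ hφ' hK hKφ
    (hΦ.comp (contDiff_const.prodMk contDiff_id) : ContDiff ℝ r (Φ t)) (hΦs t) (hΦK t)
  have hiso : IsIsotopyIn F.leafPreserving f := by
    refine ⟨?_, Diffeomorph.ext fun y => ?_, fun t L hLF => ?_⟩
    · simp only [hf]
      exact contMDiff_chartExtend hφ hφ' hK hKφ hΦ hΦφ hΦK
    -- At time `0` the support can be taken empty.
    · rw [hf, one_apply, chartExtend_eq_self (K := ∅) (fun z _ => hΦ0 z) (by simp)]
    · refine Subset.antisymm (hf t ▸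
        (mapsTo_chartExtend_of_snd_eq hVW (hL L hLF) (hΦφ t) (hΦ2 t)).image_subset) fun y hy => ?_
      have := mapsTo_chartExtend_of_snd_eq hVW (hL L hLF) (hΦsφ t) (hΦs2 t) hy
      exact ⟨(f t)⁻¹ y, hfs t ▸ this, apply_inv_self _ _⟩
  refine ⟨f 1, ⟨f, hiso, ⟨φ.symm '' K, hK.image_of_continuousOn (φ.continuousOn_symm.mono hKφ),
    fun t y hy => ?_⟩, rfl⟩, ?_⟩
  · rw [hf, chartExtend_eq_self (hΦK t) hy]
  · rw [hf, chartExtend_of_mem hx, hx0, hΦ1]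

/-- `G_F` acts transitively on each leaf of `F`. -/
theorem exists_mem_alpha_of_mem_leaf [T2Space M] [IsManifold (𝓡 n) ∞ M] {r : ℕ∞} (hr : 1 ≤ r)
    (F : Foliation n r M) {L : Set M} (hL : L ∈ F.leaves) {x y : M} (hx : x ∈ L) (hy : y ∈ L) :
    ∃ g ∈ (alpha F).1, g x = y := by
  have : IsManifold (𝓡 n) r M := IsManifold.of_le (n := ∞) (by exact_mod_cast le_top)
  obtain ⟨k, ⟨P, _, _, _, _, i, hinj, rfl, himm, hweak⟩, hchart⟩ := F.exists_dim L hL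
  -- Orbits are open in the intrinsic topology of the leaf, that of `P`.
  have key : ∀ p : P, ∀ᶠ q in 𝓝 p, ∃ g ∈ (alpha F).1, g (i p) = i q := by
    intro p
    obtain ⟨φ, V, W, hφ, hφ', hp, hp0, hV, hW, hVW, hleaf⟩ := hchart (i p) (mem_range_self p)
    have h0 : (0 : EuclideanSpace ℝ (Fin k) × EuclideanSpace ℝ (Fin (n - k))) ∈ φ.target :=
      hp0 ▸ φ.map_source hp
    have hip : φ.symm 0 = i p := by rw [← hp0, φ.left_inv hp]
    have h0' := h0
    rw [hVW] at h0'
    have hVt : ∀ v ∈ V, (v, (0 : EuclideanSpace ℝ (Fin (n - k)))) ∈ φ.target := fun v hv => by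
      rw [hVW]
      exact ⟨hv, h0'.2⟩
    have hrange : ∀ v ∈ V, ∃ q, i q = φ.symm (v, 0) := fun v hv => by
      have : (v, (0 : EuclideanSpace ℝ (Fin (n - k)))) ∈ φ '' (range i ∩ φ.source) := by
        rw [hleaf _ hL]
        exact ⟨hv, h0'.2, p, hip.symm⟩
      obtain ⟨_, ⟨⟨q, rfl⟩, hq⟩, hqv⟩ := this
      exact ⟨q, by rw [← hqv, φ.left_inv hq]⟩
    have : Nonempty P := ⟨p⟩
    have hV0 : V ∈ 𝓝 (0 : EuclideanSpace ℝ (Fin k)) := hV.mem_nhds h0'.1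
    let j : EuclideanSpace ℝ (Fin k) → P := fun v => invFun i (φ.symm (v, 0))
    have hij : ∀ v ∈ V, i (j v) = φ.symm (v, 0) := fun v hv => invFun_eq (hrange v hv)
    have hj0 : j 0 = p := hinj ((hij 0 h0'.1).trans hip)
    -- Weak imbedding is tested on `V`, locally connected as an open subset of a Euclidean space,
    -- and lifted by `ULift` to the universe of `M`.
    have hjc : ContinuousOn j V := by
      have : LocallyConnectedSpace V := hV.locallyConnectedSpace
      have : LocallyConnectedSpace (ULift.{u} V) := Homeomorph.ulift.locallyConnectedSpace
      have h1 : Continuous (i ∘ fun v : ULift.{u} V => j v.down) := by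
        have h2 : (i ∘ fun v : ULift.{u} V => j v.down) =
            fun v : ULift.{u} V => φ.symm ((v.down : EuclideanSpace ℝ (Fin k)), 0) :=
          funext fun v => hij _ v.down.2
        rw [h2]
        exact φ.continuousOn_symm.comp_continuous (by fun_prop) fun v => hVt _ v.down.2
      rw [continuousOn_iff_continuous_domRestrict]
      exact (hweak _ _ h1).comp continuous_uliftUp
    have hc : ContMDiffAt (𝓡 k) (𝓡 n) r (fun v => φ.symm (v, 0)) 0 := by
      have h1 : ContDiff ℝ r fun v : EuclideanSpace ℝ (Fin k) =>
        (v, (0 : EuclideanSpace ℝ (Fin (n - k)))) := contDiff_id.prodMk contDiff_const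
      exact (hφ'.contMDiffAt (φ.open_target.mem_nhds h0)).comp
        (0 : EuclideanSpace ℝ (Fin k)) h1.contMDiff.contMDiffAt
    have hρ : ContMDiffAt (𝓡 n) (𝓡 k) r (fun y => (φ y).1) (φ.symm (0, 0)) := by
      have h1 : ContDiff ℝ r (Prod.fst :
        EuclideanSpace ℝ (Fin k) × EuclideanSpace ℝ (Fin (n - k)) → _) := contDiff_fst
      exact h1.contMDiff.contMDiffAt.comp _
        (hφ.contMDiffAt (φ.open_source.mem_nhds (φ.map_target h0)))
    have hmap := map_nhds_eq_of_isImmersionAt (by exact_mod_cast hr) (himm.isImmersionAt p) hc hρ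
      (by filter_upwards [hV0] with v hv; rw [φ.right_inv (hVt v hv)])
      (hjc.continuousAt hV0) hj0 (by filter_upwards [hV0] with v hv using hij v hv)
    rw [← hmap, Filter.eventually_map]
    filter_upwards [hV0, exists_mem_alpha_apply_eq hr F hφ hφ' hp hp0 hVW hleaf] with v hv hg
    rwa [hij v hv]
  obtain ⟨p, rfl⟩ := hx
  obtain ⟨q, rfl⟩ := hy
  -- The complement of an orbit is a union of orbits, hence open too.
  have hO : IsClopen {q | ∃ g ∈ (alpha F).1, g (i p) = i q} := by
    constructor
    · rw [← isOpen_compl_iff, isOpen_iff_mem_nhds]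
      intro q hq
      filter_upwards [key q] with q' ⟨g, hg, hgq⟩ ⟨g', hg', hgq'⟩
      exact hq ⟨g⁻¹ * g', Subgroup.mul_mem _ (Subgroup.inv_mem _ hg) hg', by
        rw [mul_apply, hgq', ← hgq, inv_apply_self]⟩
    · rw [isOpen_iff_mem_nhds]
      rintro q ⟨g, hg, hgq⟩
      filter_upwards [key q] with q' ⟨g', hg', hgq'⟩
      exact ⟨g' * g, Subgroup.mul_mem _ hg' hg, by rw [mul_apply, hgq, hgq']⟩
  have := hO.eq_univ ⟨p, 1, Subgroup.one_mem _, rfl⟩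
  exact this.ge (mem_univ q)

/-! ### Accessible sets -/

/-- An isotopy, as an arrow defined on all of `ℝ × M`. -/
noncomputable def IsIsotopyIn.arrow {r : ℕ∞ω} {G : Subgroup (CrDiffeo n r M)} {f : ℝ → CrDiffeo n r M}
    (hf : IsIsotopyIn G f) : Arrow n r M where
  dom := univ
  toFun p := f p.1 p.2
  isOpen_dom := isOpen_univ
  contMDiffOn := hf.contMDiff.contMDiffOn
  localDiffeo t := ⟨(f t).toHomeomorph.toOpenPartialHomeomorph, by simp, fun _ _ => rfl,
    (f t).contMDiff.contMDiffOn, (f t).symm.contMDiff.contMDiffOn⟩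
  zero x _ := by simp [hf.zero]
  anti _ _ _ _ := by simp

/-- An isotopy ending at `g` is itself an arrow, so its time `1` map reaches `g x` in one step. -/
theorem apply_mem_accessibleSet {r : ℕ∞ω} {G : Subgroup (CrDiffeo n r M)}
    (hG : IsotopicallyConnected G) {g : CrDiffeo n r M} (hg : g ∈ G) (x : M) :
    g x ∈ accessibleSet (isotopyArrows G) x := by
  obtain ⟨f, hf, rfl⟩ := hG g hg
  exact ⟨_, ArrowHat.refl.step (χ := (f 1).toHomeomorph.toOpenPartialHomeomorph)
    ⟨hf.arrow, ⟨f, hf, fun _ _ => rfl⟩, 1, by simp [IsIsotopyIn.arrow], fun _ _ => rfl⟩,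
    by simp, rfl⟩

/-- The accessible sets of the isotopies in `G` lie in the orbits of `G`. -/
theorem ArrowHat.exists_mem_apply_eq {r : ℕ∞ω} {G : Subgroup (CrDiffeo n r M)}
    {ψ : OpenPartialHomeomorph M M} (hψ : ArrowHat (isotopyArrows G) ψ) {x : M}
    (hx : x ∈ ψ.source) : ∃ g ∈ G, g x = ψ x := by
  have star : ∀ χ ∈ arrowStar (isotopyArrows G), ∃ g ∈ G, ∀ y ∈ χ.source, g y = χ y := by
    rintro χ ⟨a, ⟨f, hf, hfa⟩, t, hs, hχ⟩
    refine ⟨f t, hf.mem t, fun y hy => ?_⟩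
    rw [hχ hy]
    exact (hfa (hs ▸ hy : y ∈ {x | (t, x) ∈ a.dom})).symm
  induction hψ with
  | refl => exact ⟨1, G.one_mem, rfl⟩
  | step _ hχ ih =>
    rw [OpenPartialHomeomorph.trans_source] at hx
    obtain ⟨g, hg, hgx⟩ := ih hx.1
    obtain ⟨h, hh, hhx⟩ := star _ hχ
    exact ⟨h * g, G.mul_mem hh hg, by rw [mul_apply, hgx, hhx _ hx.2]; rfl⟩
  | step_inv _ hχ ih =>
    rw [OpenPartialHomeomorph.trans_source] at hx
    obtain ⟨g, hg, hgx⟩ := ih hx.1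
    obtain ⟨h, hh, hhx⟩ := star _ hχ
    refine ⟨h⁻¹ * g, G.mul_mem (G.inv_mem hh) hg, ?_⟩
    rw [mul_apply, hgx, OpenPartialHomeomorph.trans_apply]
    conv_lhs => rw [← OpenPartialHomeomorph.right_inv _ hx.2]
    rw [← hhx _ (OpenPartialHomeomorph.map_target _ hx.2), inv_apply_self]

theorem accessibleSet_isotopyArrows {r : ℕ∞ω} {G : Subgroup (CrDiffeo n r M)}
    (hG : IsotopicallyConnected G) (x : M) :
    accessibleSet (isotopyArrows G) x = {y | ∃ g ∈ G, g x = y} := by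
  ext y
  constructor
  · rintro ⟨ψ, hψ, hx, rfl⟩
    exact hψ.exists_mem_apply_eq hx
  · rintro ⟨g, hg, rfl⟩
    exact apply_mem_accessibleSet hG hg x

theorem alpha_le_leafPreserving {r : ℕ∞ω} (F : Foliation n r M) :
    (alpha F).1 ≤ F.leafPreserving := by
  rintro _ ⟨f, hf, -, rfl⟩
  exact hf.mem 1

theorem beta_alpha [T2Space M] [IsManifold (𝓡 n) ∞ M] {r : ℕ∞} (hr : 1 ≤ r)
    (F : Foliation n r M) : beta (alpha F).toIsotopicGroups = F.leaves := by
  have orbit : ∀ L ∈ F.leaves, ∀ x ∈ L,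
      accessibleSet (isotopyArrows (alpha F).toIsotopicGroups.1) x = L := by
    intro L hL x hx
    rw [accessibleSet_isotopyArrows (alpha F).toIsotopicGroups.2]
    ext y
    constructor
    · rintro ⟨g, hg, rfl⟩
      rw [← alpha_le_leafPreserving F hg L hL]
      exact mem_image_of_mem g hx
    · exact exists_mem_alpha_of_mem_leaf hr F hL hx
  ext L
  constructor
  · rintro ⟨x, rfl⟩
    obtain ⟨L, ⟨hL, hx⟩, -⟩ := F.isPartition.2 x
    rwa [orbit L hL x hx]
  · intro hL
    obtain ⟨x, hx⟩ := Setoid.nonempty_of_mem_partition F.isPartition hL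
    exact ⟨x, orbit L hL x hx⟩

end Leaves

end StefanFoliation

theorem proposition2p4 {n : ℕ} {M : Type*} [TopologicalSpace M] [T2Space M] [ParacompactSpace M]
    [ChartedSpace (EuclideanSpace ℝ (Fin n)) M] [IsManifold (𝓡 n) ∞ M]
    (r : ℕ∞) (hr : 1 ≤ r) :
    (∀ F : StefanFoliation.Foliation n r M,
      StefanFoliation.beta (StefanFoliation.alpha F).toIsotopicGroups = F.leaves) ∧
    Injective (StefanFoliation.alpha : StefanFoliation.Foliation n r M →
      StefanFoliation.CompactIsotopicGroups n r M) := by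
  refine ⟨fun F => StefanFoliation.beta_alpha hr F, fun F F' h => ?_⟩
  ext1
  rw [← StefanFoliation.beta_alpha hr F, h, StefanFoliation.beta_alpha hr F']
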